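/- Let $F$ be a matching in a graph $G$; a vertex is \emph{free} if it lies in no edge of $F$. A path in $G$ (without repeated vertices) is \emph{$F$-alternating} if its first, third, fifth, \dots\ edges are not in $F$ and its second, fourth, \dots\ edges are in $F$. It is \emph{augmenting} if moreover it has at least one edge and both of its end vertices are free. For a path $Q$, let $E(Q)$ be its edge set. Given a finite family $\mathcal P=(P_i)_{i\in I}$ of $F$-alternating paths (repetitions allowed), an $F$-alternating path $R$ is \emph{$\mathcal P$-multicolored} if $E(R)\setminus F$ is a rainbow set of the family $(E(P_i))_{i\in I}$, that is, if there is an injective map $f:E(R)\setminus F\to I$ with $e\in E(P_{f(e)})$ for every $e\in E(R)\setminus F$. (1) If $F$ is finite, all paths in $\mathcal P$ are augmenting $F$-alternating paths, and $|\mathcal P|>2|F|$, then there is an augmenting $\mathcal P$-multicolored $F$-alternating path in $G$. (2) The bound $2|F|$ is sharp: for every integer $n\ge 0$ there are a finite graph $G$, a matching $F$ in $G$ with $|F|=n$, and a family $\mathcal P$ of $2n$ augmenting $F$-alternating paths in $G$ such that no augmenting $F$-alternating path in $G$ is $\mathcal P$-multicolored. -/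

import Mathlib

namespace SimpleGraph

variable {V : Type*} {G : SimpleGraph V}

/-- The walk `p` is an `F`-alternating path: it is a path (no repeated vertices), its odd-numbered
edges (first, third, ...) are not in `F` and its even-numbered edges (second, fourth, ...) are in
`F`. The edge numbered `i + 1` joins `p.getVert i` and `p.getVert (i + 1)`. -/
def Walk.IsAlternatingPath (F : G.Subgraph) {a b : V} (p : G.Walk a b) : Prop :=
  p.IsPath ∧ ∀ i < p.length, (F.Adj (p.getVert i) (p.getVert (i + 1)) ↔ Even (i + 1))

/-- An augmenting `F`-alternating path: an `F`-alternating path with at least one edge, both of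
whose ends lie in no edge of `F`. (For a matching `F` in Mathlib's sense, `F.support`, the set of
vertices that lie in an edge of `F`, is the whole of `F.verts`.) -/
structure Walk.IsAugmentingPath (F : G.Subgraph) {a b : V} (p : G.Walk a b) : Prop where
  alternating : p.IsAlternatingPath F
  length_pos : 0 < p.length
  free_start : a ∉ F.support
  free_end : b ∉ F.support

/-- The edges of `r` outside `F` form a rainbow set for the family of the edge sets of the walks
`P i`: distinct edges can be assigned distinct indices so that each edge lies on the walk with its
index. -/
def Walk.IsMulticolored (F : G.Subgraph) {ι : Type*} {a b : ι → V}
    (P : ∀ i, G.Walk (a i) (b i)) {c d : V} (r : G.Walk c d) : Prop :=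
  ∃ f : {e : Sym2 V // e ∈ r.edges ∧ e ∉ F.edgeSet} → ι,
    Function.Injective f ∧ ∀ e, e.1 ∈ (P (f e)).edges

end SimpleGraph

/-! Choose one edge from each of some of the paths, and let `W` consist of `F` and the chosen edges.
If `F` is not a maximum matching of some such `W`, Berge's lemma (`exists_augmenting`) gives an
augmenting path whose edges outside `F` are chosen ones, so it is multicolored. Otherwise `F` is
maximum in every such `W`, and the number of inessential vertices (those missed by some maximum
matching) serves as a potential. It is at least the number of free vertices at the start, and every
further path has an edge whose addition enlarges the inessential set. With more than `2|F|` paths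
the potential exceeds the number of vertices.

That every path helps is `IsMax.not_augmenting`, an argument from Gallai–Edmonds theory. A base is
an inessential vertex that `F` misses or matches to an essential one; each component of the
inessential vertices has exactly one base (`Linked.eq_of_isBase`, `IsMax.exists_isBase`). If no edge
of the path helped, then along the path every inessential vertex would have the base of its
component at an even position, no later than its own. The final vertex is free, so it is its own
base, but its position is odd.

For sharpness, take `n` disjoint copies of `K₄` with matching edge `12` and the paths `0123` and
`0213` in each copy. -/

namespace RainbowPath

open Finset

/-! ### Matchings as involutions, and Gallai's lemma -/

section

variable {V : Type*}

/-- An involution `m` whose nontrivial orbits are edges of `W`: a matching of `W`, the fixed points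
of `m` being the vertices it misses. -/
def IsMatch (W : SimpleGraph V) (m : V → V) : Prop :=
  (∀ x, m (m x) = x) ∧ ∀ x, m x ≠ x → W.Adj x (m x)

theorem IsMatch.mono {W W' : SimpleGraph V} {m : V → V} (h : IsMatch W m) (hW : W ≤ W') :
    IsMatch W' m := ⟨h.1, fun x hx => hW (h.2 x hx)⟩

variable [DecidableEq V]

/-- Use `m` on `T` and `n` elsewhere. -/
def glue (T : Finset V) (m n : V → V) (x : V) : V := if x ∈ T then m x else n x

/-- Remove the edge at `a` from the matching `m`. -/
def unmatch (m : V → V) (a x : V) : V := if x = a ∨ x = m a then x else m x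

/-- Add the edge `xy` to the matching `m`. -/
def addEdge (m : V → V) (x y z : V) : V := if z = x then y else if z = y then x else m z

/-- Only the edges of `m` inside `T` have to lie in `W`; this allows gluing a matching of a larger
graph when `T` avoids a deleted vertex. -/
theorem IsMatch.glue {W : SimpleGraph V} {m n : V → V} {T : Finset V} (hm : ∀ x, m (m x) = x)
    (hmW : ∀ x ∈ T, m x ≠ x → W.Adj x (m x)) (hn : IsMatch W n)
    (hTm : ∀ x ∈ T, m x ∈ T) (hTn : ∀ x ∈ T, n x ∈ T) : IsMatch W (glue T m n) := by
  refine ⟨fun x => ?_, fun x => ?_⟩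
  · by_cases hx : x ∈ T
    · simp [RainbowPath.glue, hx, hTm x hx, hm]
    · have : n x ∉ T := fun h => hx (by simpa [hn.1] using hTn _ h)
      simp [RainbowPath.glue, hx, this, hn.1]
  · by_cases hx : x ∈ T
    · simpa [RainbowPath.glue, hx] using hmW x hx
    · simpa [RainbowPath.glue, hx] using hn.2 x

theorem IsMatch.unmatch {W : SimpleGraph V} {m : V → V} (hm : IsMatch W m) (a : V) :
    IsMatch W (unmatch m a) := by
  refine ⟨fun x => ?_, fun x => ?_⟩
  · have := hm.1 x
    have := hm.1 a
    unfold RainbowPath.unmatch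
    grind
  · have := hm.2 x
    unfold RainbowPath.unmatch
    grind

theorem IsMatch.addEdge {W : SimpleGraph V} {m : V → V} (hm : IsMatch W m) {x y : V}
    (hx : m x = x) (hy : m y = y) (hxy : W.Adj x y) : IsMatch W (addEdge m x y) := by
  have hyx := hxy.symm
  have hne := hxy.ne
  refine ⟨fun z => ?_, fun z => ?_⟩
  · have := hm.1 z
    unfold RainbowPath.addEdge
    grind
  · have := hm.2 z
    unfold RainbowPath.addEdge
    grind

variable [Fintype V]

/-- The set of vertices missed by `m`. -/
def missedSet (m : V → V) : Finset V := {x | m x = x}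

@[simp] theorem mem_missedSet {m : V → V} {x : V} : x ∈ missedSet m ↔ m x = x := by
  simp [missedSet]

/-- The number of vertices missed by `m`. -/
def missed (m : V → V) : ℕ := #(missedSet m)

/-- The number of vertices of `T` missed by `m`. -/
def missedOn (T : Finset V) (m : V → V) : ℕ := #(T ∩ missedSet m)

/-- `m` is a maximum matching of `W`. -/
def IsMax (W : SimpleGraph V) (m : V → V) : Prop :=
  IsMatch W m ∧ ∀ m', IsMatch W m' → missed m ≤ missed m'

/-- The vertices missed by some maximum matching. -/
def inessential (W : SimpleGraph V) : Set V := {x | ∃ m, IsMax W m ∧ m x = x}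

/-- The nontrivial orbits of an involution are pairs, so its number of fixed points has the parity
of the number of vertices. -/
theorem missed_mod_two {m n : V → V} (hm : ∀ x, m (m x) = x) (hn : ∀ x, n (n x) = x) :
    missed m % 2 = missed n % 2 := by
  have key : ∀ f : V → V, (∀ x, f (f x) = x) → Fintype.card V % 2 = missed f % 2 := by
    intro f hf
    have h := Equiv.Perm.card_fixedPoints_modEq (p := 2) (n := 1)
      (f := (f : Function.End V)) (funext fun x => hf x)
    rw [Nat.ModEq] at h
    rw [h, missed, missedSet, ← Fintype.card_subtype]
    congr 1
  rw [← key m hm, ← key n hn]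

theorem missed_glue (T : Finset V) (m n : V → V) :
    missed (glue T m n) + missedOn T n = missed n + missedOn T m := by
  have split : ∀ f : V → V, missed f = missedOn T f + missedOn Tᶜ f := by
    intro f
    rw [missed, missedOn, missedOn, ← card_union_of_disjoint]
    · congr 1
      ext x
      by_cases hx : x ∈ T <;> simp [hx]
    · rw [disjoint_left]
      intro x
      simp +contextual
  have h1 : missedOn T (glue T m n) = missedOn T m := by
    unfold missedOn
    congr 1
    ext x
    by_cases hx : x ∈ T <;> simp [hx, glue]
  have h2 : missedOn Tᶜ (glue T m n) = missedOn Tᶜ n := by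
    unfold missedOn
    congr 1
    ext x
    by_cases hx : x ∈ T <;> simp [hx, glue]
  rw [split (glue T m n), split n, h1, h2]
  omega

theorem missed_addEdge {m : V → V} {x y : V} (hx : m x = x) (hy : m y = y) (hxy : x ≠ y) :
    missed (addEdge m x y) + 2 = missed m := by
  have h : missedSet (addEdge m x y) = missedSet m \ {x, y} := by
    ext z
    simp only [mem_missedSet, mem_sdiff, mem_insert, mem_singleton]
    unfold addEdge
    grind
  have hsub : ({x, y} : Finset V) ⊆ missedSet m := by
    intro z
    simp only [mem_missedSet, mem_insert, mem_singleton]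
    rintro (rfl | rfl) <;> assumption
  have hc := card_le_card hsub
  rw [missed, missed, h, card_sdiff_of_subset hsub]
  rw [card_pair hxy] at hc ⊢
  omega

theorem missed_unmatch {m : V → V} (hm : ∀ x, m (m x) = x) {a : V} (ha : m a ≠ a) :
    missed (unmatch m a) = missed m + 2 := by
  have h := missed_addEdge (m := unmatch m a) (x := a) (y := m a) (by simp [unmatch])
    (by simp [unmatch]) (Ne.symm ha)
  have h2 : addEdge (unmatch m a) a (m a) = m := by
    funext z
    have := hm a
    unfold addEdge unmatch
    grind
  rw [h2] at h
  exact h.symm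

theorem exists_isMax (W : SimpleGraph V) : ∃ m, IsMax W m := by
  have hne : {m : V → V | IsMatch W m}.Nonempty := ⟨id, fun _ => rfl, fun x h => (h rfl).elim⟩
  obtain ⟨m, hm, hmin⟩ := Set.exists_min_image _ missed (Set.toFinite _) hne
  exact ⟨m, hm, hmin⟩

theorem IsMax.missed_eq {W : SimpleGraph V} {m n : V → V} (hm : IsMax W m) (hn : IsMax W n) :
    missed m = missed n := le_antisymm (hm.2 n hn.1) (hn.2 m hm.1)

theorem IsMax.of_le {W : SimpleGraph V} {m n : V → V} (hm : IsMax W m) (hn : IsMatch W n)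
    (h : missed n ≤ missed m) : IsMax W n := ⟨hn, fun k hk => h.trans (hm.2 k hk)⟩

/-- A maximum matching does not miss two adjacent vertices. -/
theorem IsMax.not_adj {W : SimpleGraph V} {m : V → V} (hm : IsMax W m) {x y : V} (hx : m x = x)
    (hy : m y = y) : ¬ W.Adj x y := by
  intro h
  have h1 := missed_addEdge hx hy h.ne
  have h2 := hm.2 _ (hm.1.addEdge hx hy h)
  omega

/-- Reachability inside the set of inessential vertices. -/
def Linked (W : SimpleGraph V) : V → V → Prop :=
  Relation.ReflTransGen fun a b => W.Adj a b ∧ a ∈ inessential W ∧ b ∈ inessential W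

theorem Linked.symm {W : SimpleGraph V} {u v : V} (h : Linked W u v) : Linked W v u := by
  have : Std.Symm fun a b => W.Adj a b ∧ a ∈ inessential W ∧ b ∈ inessential W :=
    ⟨fun a b h => ⟨h.1.symm, h.2.2, h.2.1⟩⟩
  exact Relation.ReflTransGen.stdSymm.symm _ _ h

/-- Gallai's lemma: a maximum matching misses at most one vertex of a component of the
inessential vertices. -/
theorem Linked.eq_of_missed {W : SimpleGraph V} {u v : V} (h : Linked W u v) :
    ∀ {N : V → V}, IsMax W N → N u = u → N v = v → u = v := by
  induction h using Relation.ReflTransGen.head_induction_on with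
  | refl => intros; rfl
  | @head u t hut _ ih =>
    intro N hN hNu hNv
    by_contra huv
    have hNt : N t ≠ t := fun h => hN.not_adj hNu h hut.1
    obtain ⟨M₀, hM₀, hM₀t⟩ := hut.2.2
    -- `t` is the vertex after `u` on the walk to `v`. Among the maximum matchings that miss `t`,
    -- `M` is one that differs least from `N`.
    obtain ⟨M, ⟨hM, hMt⟩, hmin⟩ := Set.exists_min_image {M | IsMax W M ∧ M t = t}
      (fun M => #{x | M x ≠ N x}) (Set.toFinite _) ⟨M₀, hM₀, hM₀t⟩
    have hMu : M u ≠ u := fun h => hM.not_adj h hMt hut.1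
    have hMv : M v ≠ v := fun h => hNt (ih hM hMt h ▸ hNv)
    -- `M` covers `u` and `v` but misses as many vertices as `N`, so it misses some `x ≠ t` that `N`
    -- covers. Trading the `M`-edge at `N x` for the edge from `x` to `N x` keeps `M` maximum and
    -- `t` missed, and brings `M` closer to `N`.
    have hcard : #(missedSet M \ missedSet N) =
        #(missedSet N \ missedSet M) :=
      card_sdiff_comm (hM.missed_eq hN)
    have htwo : 1 < #(missedSet N \ missedSet M) :=
      one_lt_card.2 ⟨u, by simp [hNu, hMu], v, by simp [hNv, hMv], huv⟩
    rw [← hcard] at htwo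
    obtain ⟨x, hx, hxt⟩ := exists_mem_ne htwo t
    simp only [mem_sdiff, mem_missedSet] at hx
    obtain ⟨hMx, hNx⟩ := hx
    have hadj := hN.1.2 x hNx
    have hMy : M (N x) ≠ N x := fun h => hM.not_adj hMx h hadj
    have hU : IsMatch W (addEdge (unmatch M (N x)) x (N x)) := by
      refine (hM.1.unmatch (N x)).addEdge ?_ (by simp [unmatch]) hadj
      unfold unmatch
      grind
    have hinvM := hM.1.1
    have hinvN := hN.1.1
    have hmiss : missed (addEdge (unmatch M (N x)) x (N x)) = missed M := by
      have h1 := missed_unmatch hinvM hMy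
      have h2 := missed_addEdge (m := unmatch M (N x)) (x := x) (y := N x)
        (by unfold unmatch; grind) (by simp [unmatch]) (Ne.symm hNx)
      omega
    have hle := hmin (addEdge (unmatch M (N x)) x (N x)) ⟨hM.of_le hU hmiss.le, by
      have := hinvM (N x)
      unfold addEdge unmatch
      grind⟩
    refine absurd hle (not_le.2 (card_lt_card ?_))
    rw [ssubset_iff_of_subset]
    · refine ⟨x, ?_, ?_⟩
      · simp only [mem_filter, mem_univ, true_and]
        grind
      · rw [mem_filter]
        simp [addEdge]
    · intro z
      simp only [mem_filter, mem_univ, true_and]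
      have := hinvN x
      have := hinvM (N x)
      unfold addEdge unmatch
      grind

end

/-! ### Alternating paths of two matchings -/

section

variable {V : Type*}

/-- The alternating sequence from `z`, using `m` first. -/
def altSeq (m n : V → V) (z : V) : ℕ → V
  | 0 => z
  | i + 1 => if Even i then m (altSeq m n z i) else n (altSeq m n z i)

theorem altSeq_succ (m n : V → V) (z : V) (i : ℕ) :
    altSeq m n z (i + 1) = if Even i then m (altSeq m n z i) else n (altSeq m n z i) := rfl

theorem altSeq_eq_of_succ {m n : V → V} (hm : ∀ x, m (m x) = x) (hn : ∀ x, n (n x) = x) (z : V)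
    (i : ℕ) : altSeq m n z i =
      if Even i then m (altSeq m n z (i + 1)) else n (altSeq m n z (i + 1)) := by
  rw [altSeq_succ]
  split_ifs <;> simp [hm, hn]

/-- Positions `i` and `i + d + 1` are compared. For even `d` the step out of the first and the step
into the second use the same involution, so a coincidence moves inwards to a shorter gap. For odd
`d` it moves back by one at both positions, until the first is `z`; there `n z = z` makes the
sequence stop at step `d`. -/
theorem altSeq_ne {m n : V → V} (hm : ∀ x, m (m x) = x) (hn : ∀ x, n (n x) = x) {z : V}
    (hz : n z = z) {k : ℕ} (hk : ∀ i < k, altSeq m n z (i + 1) ≠ altSeq m n z i) (d : ℕ) :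
    ∀ i, i + d + 1 ≤ k → altSeq m n z i ≠ altSeq m n z (i + d + 1) := by
  induction d using Nat.strong_induction_on with
  | _ d ihd =>
    intro i
    induction i with
    | zero =>
      intro hi h
      rcases Nat.even_or_odd d with hd | hd
      · obtain rfl | ⟨e, rfl⟩ : d = 0 ∨ ∃ e, d = e + 2 := by
          rcases d with _ | _ | e
          · simp
          · simp at hd
          · exact Or.inr ⟨e, rfl⟩
        · exact hk 0 (by omega) h.symm
        · refine ihd e (by omega) 1 (by omega) ?_
          have h1 := altSeq_eq_of_succ hm hn z (0 + (e + 2))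
          rw [if_pos (by simpa using hd), ← h] at h1
          have h2 := altSeq_succ m n z 0
          rw [if_pos (by simp)] at h2
          rw [show 1 + e + 1 = 0 + (e + 2) by omega, h1]
          exact h2
      · have h1 := altSeq_eq_of_succ hm hn z (0 + d)
        rw [if_neg (by simpa using hd), ← h] at h1
        refine hk d (by omega) ?_
        rw [zero_add] at h h1
        rw [h1, ← h]
        exact hz.symm
    | succ i ihi =>
      intro hi h
      rcases Nat.even_or_odd d with hd | hd
      · obtain rfl | ⟨e, rfl⟩ : d = 0 ∨ ∃ e, d = e + 2 := by
          rcases d with _ | _ | e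
          · simp
          · simp at hd
          · exact Or.inr ⟨e, rfl⟩
        · exact hk (i + 1) (by omega) h.symm
        · refine ihd e (by omega) (i + 2) (by omega) ?_
          have h1 := altSeq_eq_of_succ hm hn z (i + 1 + (e + 2))
          rw [← h] at h1
          have h2 := altSeq_succ m n z (i + 1)
          have hp : Even (i + 1 + (e + 2)) ↔ Even (i + 1) := by grind
          rw [show i + 2 + e + 1 = i + 1 + (e + 2) by omega, h1, h2]
          simp only [hp]
      · refine ihi (by omega) ?_
        have h1 := altSeq_eq_of_succ hm hn z i
        have h2 := altSeq_eq_of_succ hm hn z (i + d + 1)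
        have hp : Even (i + d + 1) ↔ Even i := by grind
        rw [show i + d + 1 + 1 = i + 1 + d + 1 by omega, ← h] at h2
        rw [h1, h2]
        simp only [hp]

/-- From a vertex missed by `n`, the sequence alternating between `m` and `n` runs without
repetition to a vertex where it stops. -/
theorem exists_alternating [Finite V] {m n : V → V} (hm : ∀ x, m (m x) = x)
    (hn : ∀ x, n (n x) = x) {z : V} (hz : n z = z) : ∃ (k : ℕ) (s : ℕ → V), s 0 = z ∧
      Set.InjOn s (Set.Iic k) ∧ (∀ i < k, s (i + 1) = if Even i then m (s i) else n (s i)) ∧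
      ((Even k ∧ m (s k) = s k) ∨ (Odd k ∧ n (s k) = s k)) := by
  classical
  have hinj : ∀ k, (∀ i < k, altSeq m n z (i + 1) ≠ altSeq m n z i) →
      Set.InjOn (altSeq m n z) (Set.Iic k) := by
    intro k hk
    have key : ∀ i j, i < j → j ≤ k → altSeq m n z i ≠ altSeq m n z j := by
      intro i j hij hj
      obtain ⟨d, rfl⟩ := Nat.exists_eq_add_of_lt hij
      exact altSeq_ne hm hn hz hk d i hj
    intro i hi j hj h
    rcases lt_trichotomy i j with h1 | h1 | h1
    · exact (key i j h1 hj h).elim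
    · exact h1
    · exact (key j i h1 hi h.symm).elim
  have hex : ∃ k, altSeq m n z (k + 1) = altSeq m n z k := by
    by_contra! hne
    refine not_injective_infinite_finite (altSeq m n z) fun i j h => ?_
    exact hinj (max i j) (fun i _ => hne i) (le_max_left i j) (le_max_right i j) h
  refine ⟨Nat.find hex, altSeq m n z, rfl, hinj _ fun i hi => Nat.find_min hex hi,
    fun i _ => rfl, ?_⟩
  have h := Nat.find_spec hex
  rw [altSeq_succ] at h
  rcases Nat.even_or_odd (Nat.find hex) with he | ho
  · exact Or.inl ⟨he, by simpa [he] using h⟩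
  · exact Or.inr ⟨ho, by simpa [Nat.not_even_iff_odd.2 ho] using h⟩

/-- The set of vertices of an alternating sequence. -/
theorem exists_alternating_set [Finite V] {m n : V → V} (hm : ∀ x, m (m x) = x)
    (hn : ∀ x, n (n x) = x) {z : V} (hz : n z = z) : ∃ T : Finset V, z ∈ T ∧
      (∀ x ∈ T, m x ∈ T) ∧ (∀ x ∈ T, n x ∈ T) ∧
      ((∃ w ∈ T, m w = w ∧ ∀ x ∈ T, n x = x → x = z) ∨
        (∃ k s, s 0 = z ∧ Odd k ∧ Set.InjOn s (Set.Iic k) ∧ n (s k) = s k ∧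
          (∀ i < k, s (i + 1) = if Even i then m (s i) else n (s i)) ∧
          (∀ x ∈ T, m x ≠ x) ∧ ∀ x ∈ T, n x = x → x = z ∨ x = s k)) := by
  classical
  obtain ⟨k, s, h0, hinj, hs, hend⟩ := exists_alternating hm hn hz
  have hne : ∀ i < k, s (i + 1) ≠ s i := by
    intro i hi h
    have := hinj (show i + 1 ≤ k by omega) (show i ≤ k by omega) h
    omega
  have hprev : ∀ i < k, s i = if Even i then m (s (i + 1)) else n (s (i + 1)) := by
    intro i hi
    rw [hs i hi]
    split_ifs <;> simp [hm, hn]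
  have hmem : ∀ i ≤ k, s i ∈ (range (k + 1)).image s := fun i hi =>
    mem_image_of_mem s (by simp; omega)
  have hmfix : ∀ i < k, m (s i) ≠ s i := by
    intro i hi h
    rcases Nat.even_or_odd i with he | ho
    · have := hs i hi
      rw [if_pos he] at this
      exact hne i hi (this.trans h)
    · obtain ⟨j, rfl⟩ : ∃ j, i = j + 1 := ⟨i - 1, by grind⟩
      have := hprev j (by omega)
      rw [if_pos (by grind)] at this
      exact hne j (by omega) (h.symm.trans this.symm)
  have hnfix : ∀ i < k, 0 < i → n (s i) ≠ s i := by
    intro i hi hi0 h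
    rcases Nat.even_or_odd i with he | ho
    · obtain ⟨j, rfl⟩ : ∃ j, i = j + 1 := ⟨i - 1, by grind⟩
      have := hprev j (by omega)
      rw [if_neg (by grind)] at this
      exact hne j (by omega) (h.symm.trans this.symm)
    · have := hs i hi
      rw [if_neg (Nat.not_even_iff_odd.2 ho)] at this
      exact hne i hi (this.trans h)
  refine ⟨(range (k + 1)).image s, h0 ▸ hmem 0 (by omega), ?_, ?_, ?_⟩
  · intro x hx
    obtain ⟨i, hi, rfl⟩ := mem_image.1 hx
    rw [mem_range] at hi
    rcases Nat.even_or_odd i with he | ho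
    · rcases eq_or_lt_of_le (show i ≤ k by omega) with rfl | hlt
      · rcases hend with h | h
        · rw [h.2]; exact hx
        · exact absurd he (Nat.not_even_iff_odd.2 h.1)
      · have := hs i hlt
        rw [if_pos he] at this
        rw [← this]
        exact hmem _ hlt
    · obtain ⟨j, rfl⟩ : ∃ j, i = j + 1 := ⟨i - 1, by grind⟩
      have := hprev j (by omega)
      rw [if_pos (by grind)] at this
      rw [← this]
      exact hmem _ (by omega)
  · intro x hx
    obtain ⟨i, hi, rfl⟩ := mem_image.1 hx
    rw [mem_range] at hi
    rcases Nat.even_or_odd i with he | ho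
    · rcases Nat.eq_zero_or_pos i with rfl | hpos
      · rw [h0, hz, ← h0]; exact hx
      · obtain ⟨j, rfl⟩ : ∃ j, i = j + 1 := ⟨i - 1, by omega⟩
        have := hprev j (by omega)
        rw [if_neg (by grind)] at this
        rw [← this]
        exact hmem _ (by omega)
    · rcases eq_or_lt_of_le (show i ≤ k by omega) with rfl | hlt
      · rcases hend with h | h
        · exact absurd h.1 (Nat.not_even_iff_odd.2 ho)
        · rw [h.2]; exact hx
      · have := hs i hlt
        rw [if_neg (Nat.not_even_iff_odd.2 ho)] at this
        rw [← this]
        exact hmem _ hlt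
  · have hnk : ∀ i ≤ k, n (s i) = s i → i = 0 ∨ i = k := by
      intro i hi h
      by_contra! hc
      exact hnfix i (by omega) (by omega) h
    rcases hend with ⟨he, hk⟩ | ⟨ho, hk⟩
    · refine Or.inl ⟨s k, hmem k le_rfl, hk, ?_⟩
      intro x hx hxn
      obtain ⟨i, hi, rfl⟩ := mem_image.1 hx
      rw [mem_range] at hi
      rcases hnk i (by omega) hxn with rfl | rfl
      · exact h0
      · rcases Nat.eq_zero_or_pos i with rfl | hpos
        · exact h0
        · obtain ⟨j, rfl⟩ : ∃ j, i = j + 1 := ⟨i - 1, by omega⟩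
          have := hprev j (by omega)
          rw [if_neg (by grind)] at this
          exact (hne j (by omega) (hxn.symm.trans this.symm)).elim
    · refine Or.inr ⟨k, s, h0, ho, hinj, hk, hs, ?_, ?_⟩
      · intro x hx hxm
        obtain ⟨i, hi, rfl⟩ := mem_image.1 hx
        rw [mem_range] at hi
        rcases eq_or_lt_of_le (show i ≤ k by omega) with rfl | hlt
        · obtain ⟨j, rfl⟩ : ∃ j, i = j + 1 := ⟨i - 1, by grind⟩
          have := hprev j (by omega)
          rw [if_pos (by grind)] at this
          exact hne j (by omega) (hxm.symm.trans this.symm)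
        · exact hmfix i hlt hxm
      · intro x hx hxn
        obtain ⟨i, hi, rfl⟩ := mem_image.1 hx
        rw [mem_range] at hi
        rcases hnk i (by omega) hxn with rfl | rfl
        · exact Or.inl h0
        · exact Or.inr rfl

end

/-! ### Berge's lemma and the stability lemma -/

section

variable {V : Type*}

theorem IsMatch.fixed_of_delete {W : SimpleGraph V} {a : V} {m : V → V} (hm : IsMatch (W.deleteIncidenceSet a) m) :
    m a = a := by
  by_contra h
  have := hm.2 a h
  rw [SimpleGraph.deleteIncidenceSet_adj] at this
  exact this.2.1 rfl

variable [DecidableEq V]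

theorem IsMatch.unmatch_delete {W : SimpleGraph V} {m : V → V} (hm : IsMatch W m) (a : V) :
    IsMatch (W.deleteIncidenceSet a) (RainbowPath.unmatch m a) := by
  refine ⟨(hm.unmatch a).1, fun x hx => ?_⟩
  rw [SimpleGraph.deleteIncidenceSet_adj]
  refine ⟨(hm.unmatch a).2 x hx, ?_, ?_⟩
  · rintro rfl
    simp [RainbowPath.unmatch] at hx
  · have := hm.1 x
    unfold RainbowPath.unmatch at hx ⊢
    grind

variable [Fintype V]

/-- Berge's lemma: a matching that is not maximum has an augmenting path. -/
theorem exists_augmenting {W : SimpleGraph V} {F : V → V} (hF : IsMatch W F) (hmax : ¬ IsMax W F) :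
    ∃ (k : ℕ) (s : ℕ → V), Odd k ∧ Set.InjOn s (Set.Iic k) ∧ F (s 0) = s 0 ∧ F (s k) = s k ∧
      (∀ i < k, Even i → W.Adj (s i) (s (i + 1))) ∧ ∀ i < k, Odd i → s (i + 1) = F (s i) := by
  have hex : {m | IsMatch W m ∧ missed m < missed F}.Nonempty := by
    by_contra hne
    refine hmax ⟨hF, fun m hm => ?_⟩
    by_contra! hlt
    exact hne ⟨m, hm, hlt⟩
  -- Taking a better matching `m` closest to `F` rules out the alternating paths that end at a
  -- vertex missed by `m`: switching `m` to `F` on such a path loses nothing and reduces the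
  -- difference.
  obtain ⟨m, ⟨hm, hlt⟩, hmin⟩ := Set.exists_min_image _ (fun m => #{x | m x ≠ F x})
    (Set.toFinite _) hex
  obtain ⟨z, hzF, hzm⟩ := exists_mem_notMem_of_card_lt_card hlt
  rw [mem_missedSet] at hzF hzm
  obtain ⟨T, hzT, hTm, hTF, ⟨w, hwT, hw, hfix⟩ | ⟨k, s, h0, hk, hinj, hsk, hs, -, -⟩⟩ :=
    exists_alternating_set hm.1 hF.1 hzF
  · exfalso
    have h1 : missedOn T F ≤ 1 := by
      rw [missedOn, card_le_one_iff]
      intro x y hx hy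
      simp only [mem_inter, mem_missedSet] at hx hy
      rw [hfix x hx.1 hx.2, hfix y hy.1 hy.2]
    have h2 : 0 < missedOn T m := card_pos.2 ⟨w, by simp [hwT, hw]⟩
    have h3 := missed_glue T F m
    have hle := hmin (glue T F m) ⟨hm.glue hF.1 (fun x _ => hF.2 x) hTF hTm, by omega⟩
    refine absurd hle (not_le.2 (card_lt_card ?_))
    rw [ssubset_iff_of_subset]
    · refine ⟨z, ?_, ?_⟩
      · rw [mem_filter, hzF]
        exact ⟨mem_univ _, hzm⟩
      · rw [mem_filter]
        simp [glue, hzT]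
    · intro x
      simp only [mem_filter, mem_univ, true_and]
      unfold glue
      split_ifs <;> simp
  · refine ⟨k, s, hk, hinj, h0 ▸ hzF, hsk, fun i hi he => ?_, fun i hi ho => ?_⟩
    · have h := hs i hi
      rw [if_pos he] at h
      rw [h]
      refine hm.2 _ fun h' => ?_
      have := hinj (show i + 1 ≤ k by omega) (show i ≤ k by omega) (h.trans h')
      omega
    · rw [hs i hi, if_neg (Nat.not_even_iff_odd.2 ho)]

section Stability

variable {W : SimpleGraph V} {a x : V}

/-- A matching of the smaller graph misses `a`, so it is not maximum in `W`; by parity it misses at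
least two more vertices than `m`. -/
theorem IsMax.unmatch_delete {m : V → V} (hm : IsMax W m) (ha : a ∉ inessential W) :
    IsMax (W.deleteIncidenceSet a) (RainbowPath.unmatch m a) := by
  refine ⟨hm.1.unmatch_delete a, fun n hn => ?_⟩
  have hnW : IsMatch W n := hn.mono (W.deleteIncidenceSet_le a)
  have h1 : ¬ missed n ≤ missed m := fun h => ha ⟨n, hm.of_le hnW h, hn.fixed_of_delete⟩
  have h2 := missed_mod_two hn.1 hm.1.1
  rw [missed_unmatch hm.1.1 fun h => ha ⟨m, hm, h⟩]
  omega

/-- Stability: deleting an essential neighbour of an inessential vertex does not change which of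
the other vertices are inessential. -/
theorem inessential_delete (ha : a ∉ inessential W) (hx : x ∈ inessential W) (hax : W.Adj a x) :
    inessential (W.deleteIncidenceSet a) = insert a (inessential W) := by
  ext b
  rw [Set.mem_insert_iff]
  constructor
  · rintro ⟨n, hn, hnb⟩
    by_contra! hb
    obtain ⟨hba, hb⟩ := hb
    have hna := hn.1.fixed_of_delete
    have hnW : IsMatch W n := hn.1.mono (W.deleteIncidenceSet_le a)
    obtain ⟨M, hM, hMx⟩ := hx
    have hmissed : missed n = missed M + 2 := by
      rw [hn.missed_eq (hM.unmatch_delete ha), missed_unmatch hM.1.1 fun h => ha ⟨M, hM, h⟩]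
    obtain ⟨T, hbT, hTM, hTn, hT⟩ := exists_alternating_set hM.1.1 hn.1.1 hnb
    have hg : IsMatch W (glue T n M) := hM.1.glue hn.1.1 (fun y _ => hnW.2 y) hTn hTM
    have hgb : glue T n M b = b := by simp [glue, hbT, hnb]
    have hcount := missed_glue T n M
    -- If `a ∈ T`, the path runs between two vertices missed by `n` and avoids `x`. Switching `M` to
    -- `n` on it costs at most two missed vertices, which the edge `ax` recovers. If `a ∉ T`,
    -- switching `n` to `M` on `T` stays in the smaller graph, so maximality of `n` shows that the
    -- opposite switch costs nothing.
    by_cases haT : a ∈ T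
    · rcases hT with ⟨w, -, -, hfix⟩ | ⟨k, s, -, -, -, -, -, hMT, hnT⟩
      · exact hba (hfix a haT hna).symm
      have hxT : x ∉ T := fun h => hMT x h hMx
      have h1 : missedOn T n ≤ 2 := by
        refine (card_le_card (t := {b, s k}) fun y hy => ?_).trans card_le_two
        simp only [mem_inter, mem_missedSet] at hy
        simpa using hnT y hy.1 hy.2
      have hga : glue T n M a = a := by simp [glue, haT, hna]
      have hgx : glue T n M x = x := by simp [glue, hxT, hMx]
      have h2 := missed_addEdge hga hgx hax.ne
      refine hb ⟨_, hM.of_le (hg.addEdge hga hgx hax) (by omega), ?_⟩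
      have hbx : b ≠ x := fun h => hxT (h ▸ hbT)
      simp [addEdge, hba, hbx, hgb]
    · have h1 : IsMatch (W.deleteIncidenceSet a) (glue T M n) := by
        refine hn.1.glue hM.1.1 (fun y hy hMy => ?_) hTM hTn
        rw [SimpleGraph.deleteIncidenceSet_adj]
        exact ⟨hM.1.2 y hMy, fun h => haT (h ▸ hy), fun h => haT (h ▸ hTM y hy)⟩
      have h2 := hn.2 _ h1
      have h3 := missed_glue T M n
      exact hb ⟨_, hM.of_le hg (by omega), hgb⟩
  · rintro (rfl | ⟨m, hm, hmb⟩)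
    · obtain ⟨m, hm⟩ := exists_isMax (W.deleteIncidenceSet b)
      exact ⟨m, hm, hm.1.fixed_of_delete⟩
    · refine ⟨_, hm.unmatch_delete ha, ?_⟩
      unfold unmatch
      split_ifs <;> simp [hmb]

/-- A maximum matching sends an essential neighbour of an inessential vertex to an inessential
vertex. -/
theorem IsMax.mem_inessential {N : V → V} (hN : IsMax W N) (ha : a ∉ inessential W)
    (hx : x ∈ inessential W) (hax : W.Adj a x) : N a ∈ inessential W := by
  have h : N a ∈ inessential (W.deleteIncidenceSet a) :=
    ⟨_, hN.unmatch_delete ha, by simp [unmatch]⟩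
  rw [inessential_delete ha hx hax] at h
  exact h.resolve_left fun h' => ha ⟨N, hN, h'⟩

end Stability

/-! ### Bases of the components of inessential vertices -/

/-- The inessential vertex `u` is not matched by `N` to another inessential vertex. -/
def IsBase (W : SimpleGraph V) (N : V → V) (u : V) : Prop :=
  u ∈ inessential W ∧ (N u ∈ inessential W → N u = u)

/-- A component of the inessential vertices has at most one base. -/
theorem Linked.eq_of_isBase {W : SimpleGraph V} {N : V → V} (hN : IsMax W N) {u v : V}
    (hu : IsBase W N u) (hv : IsBase W N v) (huv : Linked W u v) : u = v := by
  induction hc : (inessential W)ᶜ.ncard using Nat.strong_induction_on generalizing W N with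
  | _ c ih =>
    subst hc
    -- Deleting such an `a` moves it into the inessential set and keeps both bases and the link.
    -- When no such `a` is left, a base cannot be matched to an essential vertex, so it is missed
    -- and Gallai's lemma applies.
    by_cases hex : ∃ a x, a ∉ inessential W ∧ x ∈ inessential W ∧ W.Adj a x
    · obtain ⟨a, x, ha, hx, hax⟩ := hex
      have hD := inessential_delete ha hx hax
      have hbase : ∀ {w}, IsBase W N w → IsBase (W.deleteIncidenceSet a) (unmatch N a) w := by
        rintro w ⟨h1, h2⟩
        rw [IsBase, hD]
        refine ⟨Or.inr h1, ?_⟩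
        have hwa : w ≠ a := fun h => ha (h ▸ h1)
        have := hN.1.1 w
        unfold unmatch
        split_ifs with h
        · simp
        · rintro (h3 | h3)
          · grind
          · exact h2 h3
      refine ih _ ?_ (hN.unmatch_delete ha) (hbase hu) (hbase hv) ?_ rfl
      · rw [hD]
        refine Set.ncard_lt_ncard ?_ (Set.toFinite _)
        rw [compl_lt_compl_iff_lt]
        exact Set.ssubset_insert ha
      · refine Relation.ReflTransGen.mono ?_ _ _ huv
        rintro p q ⟨hpq, hp, hq⟩
        rw [hD, SimpleGraph.deleteIncidenceSet_adj]
        exact ⟨⟨hpq, fun h => ha (h ▸ hp), fun h => ha (h ▸ hq)⟩, Or.inr hp, Or.inr hq⟩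
    · have hfix : ∀ {w}, IsBase W N w → N w = w := by
        rintro w ⟨h1, h2⟩
        by_contra h
        exact hex ⟨N w, w, fun h3 => h (h2 h3), h1, (hN.1.2 w h).symm⟩
      exact huv.eq_of_missed hN (hfix hu) (hfix hv)

theorem Linked.mem_inessential {W : SimpleGraph V} {u v : V} (h : Linked W u v)
    (hu : u ∈ inessential W) : v ∈ inessential W := by
  cases h using Relation.ReflTransGen.rec with
  | refl => exact hu
  | tail _ h => exact h.2.2

/-- A component of the inessential vertices has a base. -/
theorem IsMax.exists_isBase {W : SimpleGraph V} {N : V → V} (hN : IsMax W N) {x : V}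
    (hx : x ∈ inessential W) : ∃ b, IsBase W N b ∧ Linked W b x := by
  classical
  by_contra! hno
  obtain ⟨M, hM, hMx⟩ := hx
  have hx : x ∈ inessential W := ⟨M, hM, hMx⟩
  have closed : ∀ {m}, IsMax W m → ∀ y, Linked W x y → ¬ IsBase W m y →
      m y ≠ y ∧ Linked W x (m y) := by
    intro m hm y hy hb
    have hyD := hy.mem_inessential hx
    rw [IsBase, not_and, Classical.not_imp] at hb
    obtain ⟨h1, h2⟩ := hb hyD
    exact ⟨h2, hy.tail ⟨hm.1.2 y h2, hyD, h1⟩⟩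
  let K : Finset V := {y | Linked W x y}
  have memK : ∀ {y}, y ∈ K ↔ Linked W x y := by simp [K]
  have hNK : ∀ y ∈ K, N y ≠ y ∧ N y ∈ K := fun y hy => by
    rw [memK] at hy ⊢
    exact closed hN y hy fun hb => hno y hb hy.symm
  have hMK : ∀ y ∈ K, (y ≠ x → M y ≠ y) ∧ M y ∈ K := fun y hy => by
    rw [memK] at hy ⊢
    by_cases hyx : y = x
    · subst hyx
      rw [hMx]
      exact ⟨fun h => (h rfl).elim, hy⟩
    · have h := closed hM y hy fun hb => hyx
        (hy.eq_of_isBase hM ⟨hx, fun _ => hMx⟩ hb).symm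
      exact ⟨fun _ => h.1, h.2⟩
  -- Without a base, `N` matches the component `K` of `x` within itself. `M` misses `x`, its only
  -- base in `K`, and matches the rest of `K` within `K`. Extending both by the identity outside `K`
  -- gives involutions whose fixed-point counts differ by one.
  have inv : ∀ {m : V → V}, IsMatch W m → (∀ y ∈ K, m y ∈ K) → ∀ y, glue K m id (glue K m id y) = y :=
    fun hm hK => (IsMatch.glue (W := W) hm.1 (fun y _ => hm.2 y)
      ⟨fun _ => rfl, fun y h => (h rfl).elim⟩ hK fun y hy => hy).1
  have hpar := missed_mod_two (inv hN.1 fun y hy => (hNK y hy).2)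
    (inv hM.1 fun y hy => (hMK y hy).2)
  have h1 := missed_glue K N id
  have h2 := missed_glue K M id
  have h3 : missedOn K N = 0 := by
    rw [missedOn, card_eq_zero, eq_empty_iff_forall_notMem]
    intro y hy
    rw [mem_inter, mem_missedSet] at hy
    exact (hNK y hy.1).1 hy.2
  have h4 : missedOn K M = 1 := by
    rw [missedOn, card_eq_one]
    refine ⟨x, ?_⟩
    ext y
    rw [mem_inter, mem_missedSet, mem_singleton]
    constructor
    · rintro ⟨hy, hMy⟩
      by_contra h
      exact (hMK y hy).1 h hMy
    · rintro rfl
      exact ⟨memK.2 .refl, hMx⟩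
  omega

/-- If adding any single edge of a path that augments the maximum matching `F` creates neither a
larger matching nor new inessential vertices, the path does not exist. -/
theorem IsMax.not_augmenting {W : SimpleGraph V} {F : V → V} (hF : IsMax W F) {n : ℕ} {p : ℕ → V}
    (hn : Odd n) (hinj : Set.InjOn p (Set.Iic n)) (h0 : F (p 0) = p 0) (hpn : F (p n) = p n)
    (hodd : ∀ i < n, Odd i → p (i + 1) = F (p i))
    (hmax : ∀ i < n, Even i → IsMax (W ⊔ SimpleGraph.edge (p i) (p (i + 1))) F)
    (hsub : ∀ i < n, Even i →
      inessential (W ⊔ SimpleGraph.edge (p i) (p (i + 1))) ⊆ inessential W) : False := by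
  have hsup : ∀ i < n, Even i →
      inessential (W ⊔ SimpleGraph.edge (p i) (p (i + 1))) = inessential W := by
    intro i hi he
    refine (hsub i hi he).antisymm ?_
    rintro x ⟨m, hm, hmx⟩
    exact ⟨m, (hmax i hi he).of_le (hm.1.mono le_sup_left) (hm.missed_eq hF).le, hmx⟩
  have hadj : ∀ i < n, (W ⊔ SimpleGraph.edge (p i) (p (i + 1))).Adj (p i) (p (i + 1)) := by
    intro i hi
    rw [SimpleGraph.sup_adj, SimpleGraph.edge_adj]
    refine Or.inr ⟨Or.inl ⟨rfl, rfl⟩, fun h => ?_⟩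
    have := hinj (show i ≤ n by omega) (show i + 1 ≤ n by omega) h
    omega
  have base0 : ∀ j, F (p j) = p j → IsBase W F (p j) := fun j h => ⟨⟨F, hF, h⟩, fun _ => h⟩
  have key : ∀ i ≤ n, (p i ∉ inessential W ∧ Odd i ∧ F (p i) ∈ inessential W) ∨
      (p i ∈ inessential W ∧ ∃ l ≤ i, Even l ∧ IsBase W F (p l) ∧ Linked W (p l) (p i)) := by
    intro i
    induction i with
    | zero => exact fun _ => Or.inr ⟨⟨F, hF, h0⟩, 0, le_rfl, by simp, base0 0 h0, .refl⟩
    | succ i ih =>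
      intro hi
      rcases ih (by omega) with ⟨h1, h2, h3⟩ | ⟨h1, l, hl, hle, hb, hc⟩
      · have hp := hodd i (by omega) h2
        refine Or.inr ⟨hp ▸ h3, i + 1, le_rfl, by grind, ⟨hp ▸ h3, fun h => ?_⟩, .refl⟩
        rw [hp, hF.1.1] at h
        exact (h1 h).elim
      · rcases Nat.even_or_odd i with he | ho
        · have hm := hmax i (by omega) he
          have hD := hsup i (by omega) he
          by_cases hD1 : p (i + 1) ∈ inessential W
          · refine Or.inr ⟨hD1, l, by omega, hle, hb, ?_⟩
            obtain ⟨b, hb', hc'⟩ := hF.exists_isBase hD1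
            have lift : ∀ {u v}, Linked W u v →
                Linked (W ⊔ SimpleGraph.edge (p i) (p (i + 1))) u v := by
              intro u v h
              refine Relation.ReflTransGen.mono ?_ _ _ h
              rintro s t ⟨h1, h2, h3⟩
              rw [hD]
              exact ⟨Or.inl h1, h2, h3⟩
            -- The new edge joins the two components without altering the inessential set, so both
            -- bases remain bases and, now linked, must coincide.
            have hlb : p l = b := by
              refine Linked.eq_of_isBase hm (by rwa [IsBase, hD]) (by rwa [IsBase, hD]) ?_
              refine ((lift hc).tail ⟨hadj i (by omega), ?_, ?_⟩).trans (lift hc').symm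
              · rwa [hD]
              · rwa [hD]
            rwa [hlb]
          · refine Or.inl ⟨hD1, by grind, ?_⟩
            rw [← hD] at hD1 h1 ⊢
            exact hm.mem_inessential hD1 h1 (hadj i (by omega)).symm
        · have hp := hodd i (by omega) ho
          have hne : F (p i) ≠ p i := by
            rw [← hp]
            intro h
            have := hinj (show i + 1 ≤ n by omega) (show i ≤ n by omega) h
            omega
          by_cases hD1 : p (i + 1) ∈ inessential W
          · refine Or.inr ⟨hD1, l, by omega, hle, hb, hc.tail ⟨?_, h1, hD1⟩⟩
            rw [hp]
            exact hF.1.2 _ hne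
          · rw [hp] at hD1
            -- Here `p i` is matched to an essential vertex, so it is a base itself and equals `p
            -- l`, although `i` is odd and `l` even.
            have := Linked.eq_of_isBase hF hb ⟨h1, fun h => (hD1 h).elim⟩ hc
            have := hinj (show l ≤ n by omega) (show i ≤ n by omega) this
            grind
  rcases key n le_rfl with ⟨h1, -⟩ | ⟨-, l, hl, hle, hb, hc⟩
  · exact h1 ⟨F, hF, hpn⟩
  · have := hinj hl (show n ≤ n from le_rfl) (Linked.eq_of_isBase hF hb (base0 n hpn) hc)
    grind

/-! ### The rainbow theorem for sequences -/

/-- The graph whose edges are those of the matching `F` and the pairs in `E`. -/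
def edgeGraph (F : V → V) (E : Set (Sym2 V)) : SimpleGraph V :=
  SimpleGraph.fromEdgeSet (Set.range (fun x => s(x, F x)) ∪ E)

/-- The rainbow augmenting path theorem, for paths given as sequences. -/
theorem exists_rainbow_augmenting {F : V → V} (hF : ∀ x, F (F x) = x) {ι : Type*} [Fintype ι]
    (n : ι → ℕ) (p : ι → ℕ → V) (hn : ∀ i, Odd (n i))
    (hinj : ∀ i, Set.InjOn (p i) (Set.Iic (n i))) (h0 : ∀ i, F (p i 0) = p i 0)
    (hpn : ∀ i, F (p i (n i)) = p i (n i))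
    (hodd : ∀ i, ∀ j < n i, Odd j → p i (j + 1) = F (p i j))
    (hcard : Fintype.card V < missed F + Fintype.card ι) :
    ∃ (k : ℕ) (s : ℕ → V) (e : ι → Sym2 V), Odd k ∧ Set.InjOn s (Set.Iic k) ∧ F (s 0) = s 0 ∧
      F (s k) = s k ∧ (∀ i < k, Odd i → s (i + 1) = F (s i)) ∧
      ∀ i < k, Even i → ∃ c, e c = s(s i, s (i + 1)) ∧
        ∃ j < n c, e c = s(p c j, p c (j + 1)) := by
  classical
  let ok : Finset ι → (ι → Sym2 V) → Prop := fun J e =>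
    ∀ c ∈ J, ∃ j < n c, e c = s(p c j, p c (j + 1))
  have hmatch : ∀ E, IsMatch (edgeGraph F E) F := fun E => ⟨hF, fun x hx => by
    rw [edgeGraph, SimpleGraph.fromEdgeSet_adj]
    exact ⟨Or.inl ⟨x, rfl⟩, hx.symm⟩⟩
  suffices hex : ∃ J e, ok J e ∧ ¬ IsMax (edgeGraph F (e '' (J : Set ι))) F by
    obtain ⟨J, e, hok, hnot⟩ := hex
    obtain ⟨k, s, hk, hs, hs0, hsk, heven, hsodd⟩ := exists_augmenting (hmatch _) hnot
    refine ⟨k, s, e, hk, hs, hs0, hsk, hsodd, fun i hi he => ?_⟩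
    have hA := heven i hi he
    rw [edgeGraph, SimpleGraph.fromEdgeSet_adj] at hA
    obtain ⟨⟨x, hx⟩ | ⟨c, hc, hce⟩, hne⟩ := hA
    · exfalso
      have hFs : F (s i) = s (i + 1) := by
        have := hF x
        rw [Sym2.eq_iff] at hx
        grind
      rcases Nat.eq_zero_or_pos i with rfl | hpos
      · exact hne (hs0.symm.trans hFs)
      · obtain ⟨j, rfl⟩ : ∃ j, i = j + 1 := ⟨i - 1, by omega⟩
        have h1 := hsodd j (by omega) (by grind)
        rw [h1, hF] at hFs
        have := hs (show j ≤ k by omega) (show j + 1 + 1 ≤ k by omega) hFs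
        omega
    · exact ⟨c, hce, hok c hc⟩
  by_contra! hall
  have key : ∀ t ≤ Fintype.card ι, ∃ J e, ok J e ∧ #J = t ∧
      missed F + t ≤ (inessential (edgeGraph F (e '' (J : Set ι)))).ncard := by
    intro t
    induction t with
    | zero =>
      intro _
      rcases isEmpty_or_nonempty ι with hι | ⟨⟨c⟩⟩
      · have : Fintype.card ι = 0 := Fintype.card_eq_zero
        have : missed F ≤ Fintype.card V := card_le_univ _
        omega
      -- The loops are placeholders: values of `e` outside `J` play no role.
      refine ⟨∅, fun c => s(p c 0, p c 0), by simp [ok], rfl, ?_⟩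
      rw [add_zero, missed, ← Set.ncard_coe_finset]
      refine Set.ncard_le_ncard ?_ (Set.toFinite _)
      intro x hx
      exact ⟨F, hall ∅ _ (by simp [ok]), by simpa using hx⟩
    | succ t ih =>
      intro ht
      obtain ⟨J, e, hok, hJ, hD⟩ := ih (by omega)
      obtain ⟨c, hc⟩ : ∃ c, c ∉ J := by
        by_contra! h
        rw [(eq_univ_iff_forall (s := J)).2 h, card_univ] at hJ
        omega
      have hmax := hall J e hok
      have hgraph : ∀ x y, x ≠ y → edgeGraph F (e '' (J : Set ι)) ⊔ SimpleGraph.edge x y =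
          edgeGraph F (Function.update e c s(x, y) '' (insert c J : Finset ι)) := by
        intro x y hxy
        have himg : Function.update e c s(x, y) '' (J : Set ι) = e '' J :=
          Set.image_congr fun i hi => Function.update_of_ne (ne_of_mem_of_not_mem (mem_coe.1 hi) hc) _ _
        rw [coe_insert, Set.image_insert_eq, himg, Function.update_self, SimpleGraph.edge,
          edgeGraph, edgeGraph]
        simp only [Set.insert_eq, SimpleGraph.fromEdgeSet_union]
        rw [sup_assoc, sup_comm (SimpleGraph.fromEdgeSet {s(x, y)})]
      have hpne : ∀ j < n c, p c j ≠ p c (j + 1) := fun j hj h => by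
        have := hinj c (show j ≤ n c by omega) (show j + 1 ≤ n c by omega) h
        omega
      have hok' : ∀ j < n c, ok (insert c J) (Function.update e c s(p c j, p c (j + 1))) := by
        intro j hj i hi
        rcases eq_or_ne i c with rfl | hic
        · exact ⟨j, hj, by simp⟩
        · rw [Function.update_of_ne hic]
          exact hok i (mem_of_mem_insert_of_ne hi hic)
      have hmax' : ∀ j < n c,
          IsMax (edgeGraph F (e '' (J : Set ι)) ⊔ SimpleGraph.edge (p c j) (p c (j + 1))) F := by
        intro j hj
        rw [hgraph _ _ (hpne j hj)]
        exact hall _ _ (hok' j hj)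
      by_contra hno
      refine hmax.not_augmenting (hn c) (hinj c) (h0 c) (hpn c) (hodd c)
        (fun j hj _ => hmax' j hj) fun j hj _ => ?_
      by_contra hsub
      refine hno ⟨insert c J, Function.update e c s(p c j, p c (j + 1)), hok' j hj, ?_, ?_⟩
      · rw [card_insert_of_notMem hc, hJ]
      · rw [← hgraph _ _ (hpne j hj), ← add_assoc]
        refine (Nat.succ_le_succ hD).trans (Set.ncard_lt_ncard ⟨?_, hsub⟩ (Set.toFinite _))
        rintro x ⟨m, hm, hmx⟩
        exact ⟨m, (hmax' j hj).of_le (hm.1.mono le_sup_left) (hm.missed_eq hmax).le, hmx⟩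
  obtain ⟨J, e, -, -, hD⟩ := key _ le_rfl
  have h1 := Set.ncard_le_card (inessential (edgeGraph F (e '' (J : Set ι))))
  rw [Nat.card_eq_fintype_card] at h1
  omega

end

/-! ### From sequences to walks -/

section

open SimpleGraph

variable {V : Type*} {G : SimpleGraph V}

theorem exists_walk_of_seq (k : ℕ) (s : ℕ → V) (h : ∀ i < k, G.Adj (s i) (s (i + 1))) :
    ∃ r : G.Walk (s 0) (s k), r.length = k ∧ ∀ i ≤ k, r.getVert i = s i := by
  induction k generalizing s with
  | zero => exact ⟨.nil, rfl, fun i hi => by simp [Nat.le_zero.1 hi]⟩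
  | succ k ih =>
    obtain ⟨r, hr, hv⟩ := ih (fun i => s (i + 1)) fun i hi => h (i + 1) (by omega)
    refine ⟨.cons (h 0 (by omega)) r, by simp [hr], fun i hi => ?_⟩
    cases i with
    | zero => simp
    | succ i => simpa using hv i (by omega)

theorem mem_edges_iff_getVert {a b : V} (p : G.Walk a b) (E : Sym2 V) :
    E ∈ p.edges ↔ ∃ i < p.length, E = s(p.getVert i, p.getVert (i + 1)) := by
  constructor
  · intro h
    obtain ⟨i, hi, rfl⟩ := List.mem_iff_getElem.1 h
    exact ⟨i, by simpa using hi, by rw [Walk.getElem_edges]⟩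
  · rintro ⟨i, hi, rfl⟩
    rw [← Walk.getElem_edges (by simpa using hi)]
    exact List.getElem_mem _

section Partner

variable {F : G.Subgraph}

open Classical in
/-- The involution that exchanges the ends of the edges of a matching. -/
noncomputable def partner (F : G.Subgraph) (v : V) : V := if h : ∃ w, F.Adj v w then h.choose else v

theorem partner_of_adj (hF : F.IsMatching) {v w : V} (h : F.Adj v w) : partner F v = w := by
  have hex : ∃ w, F.Adj v w := ⟨w, h⟩
  rw [partner, dif_pos hex]
  exact hF.eq_of_adj_left hex.choose_spec h

theorem partner_eq_self {v : V} (h : v ∉ F.support) : partner F v = v :=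
  dif_neg h

theorem adj_partner {v : V} (h : partner F v ≠ v) : F.Adj v (partner F v) := by
  have hex : ∃ w, F.Adj v w := by
    by_contra hne
    exact h (partner_eq_self hne)
  rw [partner, dif_pos hex]
  exact hex.choose_spec

theorem notMem_support_of_partner (hF : F.IsMatching) {v : V} (h : partner F v = v) :
    v ∉ F.support := by
  rintro ⟨w, hw⟩
  rw [partner_of_adj hF hw] at h
  exact hw.ne h.symm

theorem partner_partner (hF : F.IsMatching) (v : V) : partner F (partner F v) = v := by
  by_cases h : partner F v = v
  · rw [h, h]
  · exact partner_of_adj hF (adj_partner h).symm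

theorem card_matched_le (hfin : F.edgeSet.Finite) (U : Finset V)
    (hU : ∀ v ∈ U, v ∈ F.support) : #U ≤ 2 * F.edgeSet.ncard := by
  classical
  rw [Set.ncard_eq_toFinset_card _ hfin, mul_comm]
  refine (card_le_card (t := hfin.toFinset.biUnion fun e => e.toFinset) fun v hv => ?_).trans
    (card_biUnion_le_card_mul _ _ _ fun e _ => ?_)
  · obtain ⟨w, hw⟩ := hU v hv
    rw [mem_biUnion]
    exact ⟨s(v, w), by simpa using hw, by simp⟩
  · rw [Sym2.card_toFinset]
    split_ifs <;> simp

theorem finite_support (hfin : F.edgeSet.Finite) : F.support.Finite := by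
  by_contra hinf
  obtain ⟨U, hU, hc⟩ := Set.Infinite.exists_subset_card_eq hinf (2 * F.edgeSet.ncard + 1)
  have := card_matched_le hfin U fun v hv => hU hv
  omega

end Partner

/-- If the length were even, the last edge would be in `F` and cover the free end. -/
theorem _root_.SimpleGraph.Walk.IsAugmentingPath.odd_length {F : G.Subgraph} {a b : V}
    {p : G.Walk a b} (hp : p.IsAugmentingPath F) : Odd p.length := by
  by_contra h
  have hpos := hp.length_pos
  have h1 := (hp.alternating.2 (p.length - 1) (by omega)).2 (by
    rw [Nat.sub_add_cancel hpos]; exact Nat.not_odd_iff_even.1 h)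
  rw [Nat.sub_add_cancel hpos, p.getVert_length] at h1
  exact hp.free_end ⟨_, h1.symm⟩

theorem exists_multicolored_augmenting {F : G.Subgraph} (hF : F.IsMatching)
    (hfin : F.edgeSet.Finite) {ι : Type*} [Fintype ι] (a b : ι → V)
    (P : ∀ i, G.Walk (a i) (b i)) (hP : ∀ i, (P i).IsAugmentingPath F)
    (hcard : 2 * F.edgeSet.ncard < Fintype.card ι) :
    ∃ (c d : V) (r : G.Walk c d), r.IsAugmentingPath F ∧ r.IsMulticolored F P := by
  classical
  -- `V` may be infinite; the vertices of `F` and of the given paths form a finite set closed under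
  -- `partner F`.
  let U : Set V := F.support ∪ ⋃ i, {v | v ∈ (P i).support}
  have hUfin : U.Finite :=
    (finite_support hfin).union (Set.finite_iUnion fun i => List.finite_toSet _)
  have : Fintype U := hUfin.fintype
  have hFU : ∀ v ∈ U, partner F v ∈ U := by
    intro v hv
    by_cases h : partner F v = v
    · rwa [h]
    · exact Or.inl ⟨v, (adj_partner h).symm⟩
  have hPU : ∀ i j, (P i).getVert j ∈ U := fun i j =>
    Or.inr (Set.mem_iUnion.2 ⟨i, (P i).getVert_mem_support j⟩)
  let m : U → U := fun v => ⟨partner F v, hFU v v.2⟩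
  have hcount : Fintype.card U < missed m + Fintype.card ι := by
    have h1 := card_matched_le hfin ((missedSet m)ᶜ.map (Function.Embedding.subtype _)) (by
      intro v hv
      obtain ⟨u, hu, rfl⟩ := mem_map.1 hv
      rw [mem_compl, mem_missedSet] at hu
      exact ⟨_, adj_partner fun h => hu (Subtype.ext h)⟩)
    rw [card_map] at h1
    have h2 := card_add_card_compl (missedSet m)
    rw [missed]
    omega
  obtain ⟨k, s, e, hk, hinj, hs0, hsk, hodd, heven⟩ := exists_rainbow_augmenting
    (F := m) (fun x => Subtype.ext (partner_partner hF _)) (fun i => (P i).length)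
    (fun i j => ⟨(P i).getVert j, hPU i j⟩) (fun i => (hP i).odd_length)
    (fun i x hx y hy h => (hP i).alternating.1.getVert_injOn hx hy (congrArg Subtype.val h))
    (fun i => Subtype.ext (by simpa using partner_eq_self (hP i).free_start))
    (fun i => Subtype.ext (by simpa using partner_eq_self (hP i).free_end))
    (fun i j hj ho => Subtype.ext
      (partner_of_adj hF (((hP i).alternating.2 j hj).2 ho.add_one)).symm) hcount
  have hFodd : ∀ i < k, Odd i → F.Adj (s i) (s (i + 1)) := by
    intro i hi ho
    have h := congrArg Subtype.val (hodd i hi ho)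
    change (s (i + 1) : V) = partner F (s i) at h
    rw [h]
    refine adj_partner fun h' => ?_
    have := hinj (show i + 1 ≤ k by omega) (show i ≤ k by omega) (Subtype.ext (h.trans h'))
    omega
  have hFeven : ∀ i < k, Even i → ¬ F.Adj (s i) (s (i + 1)) := by
    intro i hi he h
    rcases Nat.eq_zero_or_pos i with rfl | hpos
    · exact notMem_support_of_partner hF (congrArg Subtype.val hs0) ⟨_, h⟩
    · obtain ⟨j, rfl⟩ : ∃ j, i = j + 1 := ⟨i - 1, by omega⟩
      have h1 := hFodd j (by omega) (by grind)
      have := hinj (show j ≤ k by omega) (show j + 1 + 1 ≤ k by omega)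
        (Subtype.ext (hF.eq_of_adj_left h1.symm h))
      omega
  have hcol : ∀ i < k, Even i → ∃ c, (e c).map Subtype.val = s((s i : V), (s (i + 1) : V)) ∧
      (e c).map Subtype.val ∈ (P c).edges := by
    intro i hi he
    obtain ⟨c, hc, j, hj, hcj⟩ := heven i hi he
    refine ⟨c, by rw [hc]; rfl, ?_⟩
    rw [mem_edges_iff_getVert]
    exact ⟨j, hj, by rw [hcj]; rfl⟩
  have hadj : ∀ i < k, G.Adj (s i) (s (i + 1)) := by
    intro i hi
    rcases Nat.even_or_odd i with he | ho
    · obtain ⟨c, hc, hmem⟩ := hcol i hi he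
      rw [hc] at hmem
      exact (P c).adj_of_mem_edges hmem
    · exact (hFodd i hi ho).adj_sub
  obtain ⟨r, hr, hv⟩ := exists_walk_of_seq k (fun i => (s i : V)) hadj
  refine ⟨_, _, r, ⟨⟨?_, fun i hi => ?_⟩, ?_, ?_, ?_⟩, ?_⟩
  · rw [← Walk.IsPath.getVert_injOn_iff]
    intro i hi j hj h
    rw [Set.mem_ofPred_eq, hr] at hi hj
    rw [hv i hi, hv j hj] at h
    exact hinj hi hj (Subtype.ext h)
  · rw [hr] at hi
    rw [hv i hi.le, hv (i + 1) hi]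
    rcases Nat.even_or_odd i with he | ho
    · exact iff_of_false (hFeven i hi he) (Nat.not_even_iff_odd.2 he.add_one)
    · exact iff_of_true (hFodd i hi ho) ho.add_one
  · rw [hr]
    exact hk.pos
  · exact notMem_support_of_partner hF (congrArg Subtype.val hs0)
  · exact notMem_support_of_partner hF (congrArg Subtype.val hsk)
  · have hex : ∀ E : {E : Sym2 V // E ∈ r.edges ∧ E ∉ F.edgeSet},
        ∃ c, (e c).map Subtype.val = E.1 ∧ E.1 ∈ (P c).edges := by
      rintro ⟨E, hE, hEF⟩
      obtain ⟨i, hi, rfl⟩ := (mem_edges_iff_getVert r E).1 hE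
      rw [hr] at hi
      rw [hv i hi.le, hv (i + 1) hi, Subgraph.mem_edgeSet] at hEF
      have he : Even i := by
        by_contra ho
        exact hEF (hFodd i hi (Nat.not_even_iff_odd.1 ho))
      obtain ⟨c, hc, hmem⟩ := hcol i hi he
      have hrE : s(r.getVert i, r.getVert (i + 1)) = s((s i : V), (s (i + 1) : V)) := by
        rw [hv i hi.le, hv (i + 1) hi]
      rw [hc, ← hrE] at hmem
      exact ⟨c, hc.trans hrE.symm, hmem⟩
    choose f hf using hex
    -- Distinct edges get distinct indices because `e` recovers the edge from its index.
    refine ⟨f, fun E E' h => Subtype.ext ?_, fun E => (hf E).2⟩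
    rw [← (hf E).1, h, (hf E').1]

end

/-! ### Sharpness: disjoint copies of `K₄` -/

section

open SimpleGraph

/-- The disjoint union of `n` complete graphs on four vertices. -/
def quads (n : ℕ) : SimpleGraph (Fin n × Fin 4) where
  Adj u v := u.1 = v.1 ∧ u.2 ≠ v.2
  symm := ⟨fun _ _ h => ⟨h.1.symm, h.2.symm⟩⟩
  loopless := ⟨fun _ h => h.2 rfl⟩

theorem quads_adj {n : ℕ} (i : Fin n) {x y : Fin 4} (h : x ≠ y) : (quads n).Adj (i, x) (i, y) :=
  ⟨rfl, h⟩

/-- The matching that consists of the edge `12` of each component. -/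
def quadsMatching (n : ℕ) : (quads n).Subgraph where
  verts := {v | v.2 = 1 ∨ v.2 = 2}
  Adj u v := u.1 = v.1 ∧ (u.2 = 1 ∧ v.2 = 2 ∨ u.2 = 2 ∧ v.2 = 1)
  adj_sub := by
    rintro u v ⟨h, h1 | h1⟩ <;> exact ⟨h, by rw [h1.1, h1.2]; decide⟩
  edge_vert := by
    rintro u v ⟨h, h1 | h1⟩
    · exact Or.inl h1.1
    · exact Or.inr h1.1
  symm := ⟨by
    rintro u v ⟨h, h1 | h1⟩
    · exact ⟨h.symm, Or.inr ⟨h1.2, h1.1⟩⟩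
    · exact ⟨h.symm, Or.inl ⟨h1.2, h1.1⟩⟩⟩

theorem quadsMatching_isMatching (n : ℕ) : (quadsMatching n).IsMatching := by
  rintro ⟨i, x⟩ (h | h)
  · refine ⟨(i, 2), ⟨rfl, Or.inl ⟨h, rfl⟩⟩, ?_⟩
    rintro ⟨j, y⟩ ⟨h1, ⟨h2, h3⟩ | ⟨h2, h3⟩⟩ <;> simp_all
  · refine ⟨(i, 1), ⟨rfl, Or.inr ⟨h, rfl⟩⟩, ?_⟩
    rintro ⟨j, y⟩ ⟨h1, ⟨h2, h3⟩ | ⟨h2, h3⟩⟩ <;> simp_all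

theorem quadsMatching_edgeSet_ncard (n : ℕ) : (quadsMatching n).edgeSet.ncard = n := by
  have h : (quadsMatching n).edgeSet =
      Set.range fun i : Fin n => s(((i, 1) : Fin n × Fin 4), (i, 2)) := by
    ext E
    induction E with
    | _ u v =>
      obtain ⟨i, x⟩ := u
      obtain ⟨j, y⟩ := v
      rw [Subgraph.mem_edgeSet]
      constructor
      · rintro ⟨h, h1 | h1⟩
        · refine ⟨i, ?_⟩
          simp_all
        · refine ⟨i, ?_⟩
          simp_all
      · rintro ⟨l, hl⟩
        simp only [Sym2.eq_iff, Prod.mk.injEq] at hl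
        rcases hl with ⟨⟨rfl, rfl⟩, rfl, rfl⟩ | ⟨⟨rfl, rfl⟩, rfl, rfl⟩
        · exact ⟨rfl, Or.inl ⟨rfl, rfl⟩⟩
        · exact ⟨rfl, Or.inr ⟨rfl, rfl⟩⟩
  rw [h, ← Set.image_univ, Set.ncard_image_of_injective, Set.ncard_univ, Nat.card_eq_fintype_card,
    Fintype.card_fin]
  intro i j hij
  simp only [Sym2.eq_iff, Prod.mk.injEq] at hij
  rcases hij with h | h
  · exact h.1.1
  · exact h.1.1

/-- The neighbour of `0` on the path of colour `κ`. -/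
def near (κ : Fin 2) : Fin 4 := if κ = 0 then 1 else 2

/-- The neighbour of `3` on the path of colour `κ`. -/
def far (κ : Fin 2) : Fin 4 := if κ = 0 then 2 else 1

theorem zero_ne_near : ∀ κ, 0 ≠ near κ := by decide

theorem near_ne_far : ∀ κ, near κ ≠ far κ := by decide

theorem far_ne_three : ∀ κ, far κ ≠ 3 := by decide

/-- The path of colour `κ` in the component `i`. -/
def quadPath {n : ℕ} (κ : Fin 2) (i : Fin n) : (quads n).Walk (i, 0) (i, 3) :=
  .cons (v := (i, near κ)) (quads_adj i (zero_ne_near κ)) <|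
    .cons (v := (i, far κ)) (quads_adj i (near_ne_far κ)) <|
      .cons (v := (i, 3)) (quads_adj i (far_ne_three κ)) .nil

theorem quadsMatching_support (n : ℕ) (v : Fin n × Fin 4) :
    v ∈ (quadsMatching n).support ↔ v.2 = 1 ∨ v.2 = 2 := by
  rw [(quadsMatching_isMatching n).support_eq_verts]
  rfl

theorem quadPath_isAugmentingPath {n : ℕ} (κ : Fin 2) (i : Fin n) :
    (quadPath κ i).IsAugmentingPath (quadsMatching n) := by
  refine ⟨⟨?_, ?_⟩, by simp [quadPath], ?_, ?_⟩
  · rw [Walk.isPath_def]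
    simp only [quadPath, Walk.support_cons, Walk.support_nil]
    fin_cases κ <;> simp [near, far]
  · intro j hj
    simp only [quadPath, Walk.length_cons, Walk.length_nil] at hj
    have h0 : (quadPath κ i).getVert 0 = (i, 0) := rfl
    have h1 : (quadPath κ i).getVert 1 = (i, near κ) := rfl
    have h2 : (quadPath κ i).getVert 2 = (i, far κ) := rfl
    have h3 : (quadPath κ i).getVert 3 = (i, 3) := rfl
    interval_cases j <;> norm_num only [quadsMatching, h0, h1, h2, h3, true_and] <;>
      clear h0 h1 h2 h3 <;> revert κ <;> decide
  · rw [quadsMatching_support]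
    simp
  · rw [quadsMatching_support]
    simp

/-- The pair `xy` is one of the two edges of colour `κ` outside the matching. -/
def Coloured (κ : Fin 2) (x y : Fin 4) : Prop :=
  x = 0 ∧ y = near κ ∨ x = near κ ∧ y = 0 ∨ x = far κ ∧ y = 3 ∨ x = 3 ∧ y = far κ

instance (κ : Fin 2) (x y : Fin 4) : Decidable (Coloured κ x y) :=
  inferInstanceAs (Decidable (_ ∨ _))

theorem coloured_of_mem_edges {n : ℕ} {κ : Fin 2} {i : Fin n} {u v : Fin n × Fin 4}
    (h : s(u, v) ∈ (quadPath κ i).edges) (hF : ¬ (quadsMatching n).Adj u v) :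
    u.1 = i ∧ v.1 = i ∧ Coloured κ u.2 v.2 := by
  obtain ⟨u1, u2⟩ := u
  obtain ⟨v1, v2⟩ := v
  simp only [quadPath, Walk.edges_cons, Walk.edges_nil, List.mem_cons, Sym2.eq_iff,
    Prod.mk.injEq, List.not_mem_nil, or_false] at h
  have hmid : ∀ κ : Fin 2, (near κ = 1 ∧ far κ = 2) ∨ (near κ = 2 ∧ far κ = 1) := by decide
  have hκ := hmid κ
  simp only [quadsMatching] at hF
  unfold Coloured
  grind

/-- Two different colours around the matching edge would lead back to the starting vertex. -/
theorem coloured_eq : ∀ (κ κ' : Fin 2) (x₀ x₁ x₂ x₃ : Fin 4), ¬ (x₀ = 1 ∨ x₀ = 2) →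
    Coloured κ x₀ x₁ → (x₁ = 1 ∧ x₂ = 2 ∨ x₁ = 2 ∧ x₂ = 1) → Coloured κ' x₂ x₃ → x₃ ≠ x₀ →
    κ = κ' := by decide

theorem coloured_matched : ∀ (κ : Fin 2) (x₀ x₁ : Fin 4), ¬ (x₀ = 1 ∨ x₀ = 2) →
    Coloured κ x₀ x₁ → x₁ = 1 ∨ x₁ = 2 := by decide

/-- The family of the two coloured paths in each component. -/
def quadFamily (n : ℕ) (t : Fin (2 * n)) : (quads n).Walk
    ((finProdFinEquiv.symm t).2, 0) ((finProdFinEquiv.symm t).2, 3) :=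
  quadPath (finProdFinEquiv.symm t).1 (finProdFinEquiv.symm t).2

theorem quadFamily_not_multicolored {n : ℕ} {c d : Fin n × Fin 4} {r : (quads n).Walk c d}
    (hr : r.IsAugmentingPath (quadsMatching n)) :
    ¬ r.IsMulticolored (quadsMatching n) (quadFamily n) := by
  rintro ⟨f, hf, hmem⟩
  have hpath := hr.alternating.1.getVert_injOn
  have hE : ∀ j < r.length, Even j → s(r.getVert j, r.getVert (j + 1)) ∈ r.edges ∧
      s(r.getVert j, r.getVert (j + 1)) ∉ (quadsMatching n).edgeSet := by
    intro j hj he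
    refine ⟨(mem_edges_iff_getVert r _).2 ⟨j, hj, rfl⟩, ?_⟩
    rw [Subgraph.mem_edgeSet, hr.alternating.2 j hj]
    exact Nat.not_even_iff_odd.2 he.add_one
  have hcol : ∀ j (hj : j < r.length) (he : Even j),
      (r.getVert j).1 = (finProdFinEquiv.symm (f ⟨_, hE j hj he⟩)).2 ∧
      (r.getVert (j + 1)).1 = (finProdFinEquiv.symm (f ⟨_, hE j hj he⟩)).2 ∧
      Coloured (finProdFinEquiv.symm (f ⟨_, hE j hj he⟩)).1 (r.getVert j).2
        (r.getVert (j + 1)).2 :=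
    fun j hj he => coloured_of_mem_edges (hmem ⟨_, hE j hj he⟩) (hE j hj he).2
  have hpos := hr.length_pos
  have hlen : 2 < r.length := by
    have h1 : r.length ≠ 1 := by
      intro h
      obtain ⟨-, -, h1⟩ := hcol 0 hpos (by simp)
      have h2 := hr.free_start
      have h3 := hr.free_end
      rw [quadsMatching_support, ← r.getVert_zero] at h2
      rw [quadsMatching_support, ← r.getVert_length, h] at h3
      exact h3 (coloured_matched _ _ _ h2 h1)
    have := hr.odd_length
    rcases this with ⟨t, ht⟩
    omega
  obtain ⟨a1, a2, a3⟩ := hcol 0 hpos (by simp)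
  obtain ⟨b1, b2, b3⟩ := hcol 2 hlen (by simp)
  have hm : (quadsMatching n).Adj (r.getVert 1) (r.getVert 2) :=
    (hr.alternating.2 1 (by omega)).2 (by decide)
  have hfree := hr.free_start
  rw [quadsMatching_support, ← r.getVert_zero] at hfree
  have hcomp : (finProdFinEquiv.symm (f ⟨_, hE 0 hpos (by simp)⟩)).2 =
      (finProdFinEquiv.symm (f ⟨_, hE 2 hlen (by simp)⟩)).2 := by
    rw [← a2, ← b1]
    exact hm.1
  have hne : (r.getVert 3).2 ≠ (r.getVert 0).2 := by
    intro h
    have : r.getVert 3 = r.getVert 0 := Prod.ext (b2.trans (hcomp.symm.trans a1.symm)) h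
    have := hpath (show 3 ≤ r.length by omega) (show 0 ≤ r.length by omega) this
    omega
  have hκ := coloured_eq _ _ _ _ _ _ hfree a3 hm.2 b3 hne
  -- Each pair of colour and component indexes a single path of the family, so the first and third
  -- edges would share an index.
  have hff := hf (finProdFinEquiv.symm.injective (Prod.ext hκ hcomp))
  have hs := congrArg Subtype.val hff
  simp only [Sym2.eq_iff] at hs
  rcases hs with ⟨h, -⟩ | ⟨h, -⟩
  · have := hpath (show 0 ≤ r.length by omega) (show 2 ≤ r.length by omega) h
    omega
  · have := hpath (show 0 ≤ r.length by omega) (show 3 ≤ r.length by omega) h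
    omega

end

end RainbowPath

/-- The first part is the existence of the multicolored path; the second says that the bound
`2 * |F|` is sharp for every size `n` of the matching. -/
theorem mainTheorem3 :
    (∀ {V : Type*} (G : SimpleGraph V) (F : G.Subgraph) (_ : F.IsMatching) (_ : F.edgeSet.Finite)
        {ι : Type*} [Fintype ι] (a b : ι → V) (P : ∀ i, G.Walk (a i) (b i))
        (_ : ∀ i, (P i).IsAugmentingPath F) (_ : 2 * F.edgeSet.ncard < Fintype.card ι),
        ∃ (c d : V) (r : G.Walk c d),
          r.IsAugmentingPath F ∧ r.IsMulticolored F P) ∧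
    (∀ n : ℕ, ∃ (V : Type) (_ : Fintype V) (G : SimpleGraph V) (F : G.Subgraph)
        (a b : Fin (2 * n) → V) (P : ∀ i, G.Walk (a i) (b i)),
        F.IsMatching ∧ F.edgeSet.ncard = n ∧ (∀ i, (P i).IsAugmentingPath F) ∧
          ¬ ∃ (c d : V) (r : G.Walk c d),
            r.IsAugmentingPath F ∧ r.IsMulticolored F P) := by
  refine ⟨fun G F hF hfin ι _ a b P hP hcard =>
    RainbowPath.exists_multicolored_augmenting hF hfin a b P hP hcard, fun n => ?_⟩
  refine ⟨Fin n × Fin 4, inferInstance, RainbowPath.quads n, RainbowPath.quadsMatching n, _, _,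
    RainbowPath.quadFamily n, RainbowPath.quadsMatching_isMatching n,
    RainbowPath.quadsMatching_edgeSet_ncard n,
    fun t => RainbowPath.quadPath_isAugmentingPath _ _, ?_⟩
  rintro ⟨c, d, r, hr, hmul⟩
  exact RainbowPath.quadFamily_not_multicolored hr hmul
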